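/- For a function $U$ on $(0,\pi)$ let $(-\Delta)_s^{1/2}U(s)$ denote (with $L=1$) the half Laplacian of $u(x)=U(\operatorname{acot} x)$ at the point $x=\cot s$, where $\operatorname{acot}$ takes values in $(0,\pi)$ and $$(-\Delta)^{1/2}u(x)=\frac1\pi\,\mathrm{PV}\!\int_{-\infty}^{\infty}\frac{u(x)-u(x+y)}{|y|^{2}}\,dy .$$ (In particular $(-\Delta)_s^{1/2}U(s)$ is $\pi$-periodic in $s$.) Let $k$ be an odd natural number and $s\in(-\pi,0)\cup(0,\pi)$. Then the principal values defining $(-\Delta)_s^{1/2}\cos(ks)$ and $(-\Delta)_s^{1/2}\sin(ks)$ exist, and $$(-\Delta)_s^{1/2}\cos(ks)=\frac{2k}{\pi}\sin(ks)\left(\cos s+\sin^2 s\,\ln\left|\cot\frac s2\right|\right)+\frac{8k}{\pi}\sum_{n=0}^{(k-1)/2}\frac{\sin((k-1-2n)s)}{(2n-1)(2n+1)(2n+3)},$$ $$(-\Delta)_s^{1/2}\sin(ks)=-\frac{2}{\pi(k+2)}-\frac{2k}{\pi}\cos(ks)\left(\cos s+\sin^2 s\,\ln\left|\cot\frac s2\right|\right)-\frac{8k}{\pi}\sum_{n=0}^{(k-1)/2}\frac{\cos((k-1-2n)s)}{(2n-1)(2n+1)(2n+3)}.$$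 -/

import Mathlib

open Filter Topology MeasureTheory

/-- The normalising constant of the fractional Laplacian of order `α` on the real line,
`c_α = α 2^(α-1) Γ(1/2 + α/2) / (√π Γ(1 - α/2))`. -/
noncomputable def fracLaplConst (α : ℝ) : ℝ :=
  α * (2 : ℝ) ^ (α - 1) * Real.Gamma (1 / 2 + α / 2) / (Real.sqrt Real.pi * Real.Gamma (1 - α / 2))

/-- `HasFracLaplacianAt α u x v` says that `(-Δ)^(α/2) u (x)` exists and equals `v`, where
`(-Δ)^(α/2) u (x) = c_α PV ∫ (u(x) - u(x+y)) / |y|^(1+α) dy`: the integral converges absolutely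
away from `y = 0`, and `v` is the limit of the symmetric truncations around `y = 0`. -/
def HasFracLaplacianAt (α : ℝ) (u : ℝ → ℝ) (x v : ℝ) : Prop :=
  (∀ ε : ℝ, 0 < ε →
    IntegrableOn (fun y : ℝ => (u x - u (x + y)) / |y| ^ (1 + α)) {y : ℝ | ε < |y|}) ∧
  Tendsto
    (fun ε : ℝ => fracLaplConst α *
      ∫ y in {y : ℝ | ε < |y|}, (u x - u (x + y)) / |y| ^ (1 + α))
    (𝓝[>] 0) (𝓝 v)

/-- The inverse cotangent with values in `(0, π)`. -/
noncomputable def arccot (x : ℝ) : ℝ := Real.pi / 2 - Real.arctan x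

/-- `HasHalfLaplacianS L U s v` says that `(-Δ)_s^(1/2) U (s)` exists and equals `v`: it is the half
Laplacian, at the point `x = L cot s`, of the function `x ↦ U (arccot (x / L))` on the real line
(so it is `π`-periodic in `s` and depends only on `U` on `(0, π)`). -/
def HasHalfLaplacianS (L : ℝ) (U : ℝ → ℝ) (s v : ℝ) : Prop :=
  HasFracLaplacianAt 1 (fun x : ℝ => U (arccot (x / L))) (L * Real.cot s) v

/-!
In the variable `θ = arccot (cot s + y)` the kernel `dy / y ^ 2` becomes `sin² s dθ / sin² (θ - s)`
on `(0, π)`. If a primitive `G` of `(U s - U θ) / sin² (θ - s)` is singular at `s` only through a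
multiple of `log |θ - s|`, the symmetric truncations do not see the singularity, and the half
Laplacian is `sin² s / π * (G π - G 0)`.

For `U θ = e ^ (i k θ)` with `k` odd, an integration by parts leaves the primitive of
`e ^ (i k φ) / sin φ`, that is, `log |tan (φ / 2)|` plus a finite sum of the
`e ^ (i (2 j + 1) φ) / (2 j + 1)`. Multiplication by `sin² s` turns the coefficients `1 / (2 j + 1)`
into their second differences, and
`1 / (2 n - 1) - 2 / (2 n + 1) + 1 / (2 n + 3) = 8 / ((2 n - 1) (2 n + 1) (2 n + 3))`.
The two formulas are the real and imaginary parts of the result.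
-/

lemma setOf_lt_abs_eq_Iio_union_Ioi {R : Type*} [AddCommGroup R] [LinearOrder R]
    [IsOrderedAddMonoid R] (ε : R) : {y : R | ε < |y|} = Set.Iio (-ε) ∪ Set.Ioi ε := by
  ext y
  simp only [Set.mem_ofPred_eq, Set.mem_union, Set.mem_Iio, Set.mem_Ioi, lt_abs, lt_neg, or_comm]

lemma setIntegral_lt_abs_of_hasDerivAt {E : Type*} [NormedAddCommGroup E] [NormedSpace ℝ E]
    [CompleteSpace E] {f F : ℝ → E} {A B : E} {ε : ℝ} (hε : 0 < ε)
    (hf : IntegrableOn f {y : ℝ | ε < |y|}) (hF : ∀ y ≠ 0, HasDerivAt F (f y) y)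
    (hA : Tendsto F atTop (𝓝 A)) (hB : Tendsto F atBot (𝓝 B)) :
    ∫ y in {y : ℝ | ε < |y|}, f y = A - B + (F (-ε) - F ε) := by
  rw [setOf_lt_abs_eq_Iio_union_Ioi] at hf ⊢
  have hleft : ∫ y in Set.Iio (-ε), f y = F (-ε) - B := by
    rw [← integral_Iic_eq_integral_Iio]
    refine integral_Iic_of_hasDerivAt_of_tendsto' (fun y hy => hF y ?_)
      (by rw [integrableOn_Iic_iff_integrableOn_Iio]; exact hf.left_of_union) hB
    exact ((Set.mem_Iic.1 hy).trans_lt (neg_neg_of_pos hε)).ne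
  have hright : ∫ y in Set.Ioi ε, f y = A - F ε :=
    integral_Ioi_of_hasDerivAt_of_tendsto' (fun y hy => hF y (hε.trans_le hy).ne')
      hf.right_of_union hA
  have hdisj : Disjoint (Set.Iio (-ε)) (Set.Ioi ε) :=
    Set.disjoint_left.2 fun y hy hy' => by
      linarith [Set.mem_Iio.1 hy, Set.mem_Ioi.1 hy']
  rw [setIntegral_union hdisj measurableSet_Ioi hf.left_of_union hf.right_of_union, hleft, hright]
  abel

lemma integrableOn_abs_rpow_lt_abs {a ε : ℝ} (ha : a < -1) (hε : 0 < ε) :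
    IntegrableOn (fun y : ℝ => |y| ^ a) {y : ℝ | ε < |y|} := by
  have hright : IntegrableOn (fun y : ℝ => |y| ^ a) (Set.Ioi ε) :=
    (integrableOn_Ioi_rpow_of_lt ha hε).congr_fun
      (fun y hy => by simp only [abs_of_pos (hε.trans hy)]) measurableSet_Ioi
  have hleft : IntegrableOn (fun y : ℝ => |y| ^ a) (Set.Iio (-ε)) := by
    simpa [Function.comp_def] using
      ((Measure.measurePreserving_neg volume).integrableOn_comp_preimage
        (MeasurableEquiv.neg ℝ).measurableEmbedding).2 hright
  rw [setOf_lt_abs_eq_Iio_union_Ioi]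
  exact hleft.union hright

lemma integrableOn_sub_div_abs_rpow {α C : ℝ} (hα : 0 < α) {u : ℝ → ℝ} (hu : Measurable u)
    (hC : ∀ t, |u t| ≤ C) (x : ℝ) {ε : ℝ} (hε : 0 < ε) :
    IntegrableOn (fun y : ℝ => (u x - u (x + y)) / |y| ^ (1 + α)) {y : ℝ | ε < |y|} := by
  have hdecay := integrableOn_abs_rpow_lt_abs (a := -(1 + α)) (by linarith) hε
  have hbound (y : ℝ) : ‖u x - u (x + y)‖ ≤ C + C :=
    (norm_sub_le _ _).trans (add_le_add (hC _) (hC _))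
  have hmeas : Measurable fun y => u x - u (x + y) := by fun_prop
  refine (hdecay.bdd_mul hmeas.aestronglyMeasurable (.of_forall hbound)).congr
    (.of_forall fun y => ?_)
  simp only [Real.rpow_neg (abs_nonneg y), div_eq_mul_inv]

lemma hasFracLaplacianAt_of_hasDerivAt {α C : ℝ} (hα : 0 < α) {u F : ℝ → ℝ} {x A B : ℝ}
    (hu : Measurable u) (hC : ∀ t, |u t| ≤ C)
    (hF : ∀ y ≠ 0, HasDerivAt F ((u x - u (x + y)) / |y| ^ (1 + α)) y)
    (hA : Tendsto F atTop (𝓝 A)) (hB : Tendsto F atBot (𝓝 B))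
    (h0 : Tendsto (fun ε => F (-ε) - F ε) (𝓝[>] 0) (𝓝 0)) :
    HasFracLaplacianAt α u x (fracLaplConst α * (A - B)) := by
  have hint (ε : ℝ) (hε : 0 < ε) := integrableOn_sub_div_abs_rpow hα hu hC x hε
  refine ⟨hint, Tendsto.const_mul _ ?_⟩
  have hlim : Tendsto (fun ε => A - B + (F (-ε) - F ε)) (𝓝[>] 0) (𝓝 (A - B)) := by
    simpa only [add_zero] using h0.const_add (A - B)
  refine hlim.congr' ?_
  filter_upwards [self_mem_nhdsWithin] with ε hε
  exact (setIntegral_lt_abs_of_hasDerivAt hε (hint ε hε) hF hA hB).symm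

lemma fracLaplConst_one : fracLaplConst 1 = 1 / Real.pi := by
  have hsqrt : √Real.pi * √Real.pi = Real.pi := Real.mul_self_sqrt Real.pi_pos.le
  have hpi : √Real.pi ≠ 0 := (Real.sqrt_pos.2 Real.pi_pos).ne'
  norm_num [fracLaplConst, Real.Gamma_one_half_eq, Real.Gamma_one, ← mul_inv, hsqrt, hpi]

lemma continuous_arccot : Continuous arccot :=
  continuous_const.sub Real.continuous_arctan

lemma arccot_mem_Ioo (x : ℝ) : arccot x ∈ Set.Ioo 0 Real.pi := by
  constructor <;> unfold arccot <;>
    linarith [Real.arctan_lt_pi_div_two x, Real.neg_pi_div_two_lt_arctan x]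

lemma sin_arccot_pos (x : ℝ) : 0 < Real.sin (arccot x) :=
  Real.sin_pos_of_mem_Ioo (arccot_mem_Ioo x)

lemma cos_arccot (x : ℝ) : Real.cos (arccot x) = x * Real.sin (arccot x) := by
  rw [arccot, Real.cos_pi_div_two_sub, Real.sin_pi_div_two_sub, Real.cos_arctan, Real.sin_arctan]
  ring

lemma hasDerivAt_arccot (x : ℝ) : HasDerivAt arccot (-Real.sin (arccot x) ^ 2) x := by
  rw [arccot, Real.sin_pi_div_two_sub, Real.cos_sq_arctan]
  exact (Real.hasDerivAt_arctan x).const_sub _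

lemma arccot_cot {s : ℝ} (hs : s ∈ Set.Ioo 0 Real.pi) : arccot (Real.cot s) = s := by
  rw [← Real.tan_inv_eq_cot, ← Real.tan_pi_div_two_sub, arccot,
    Real.arctan_tan (by linarith [hs.2]) (by linarith [hs.1]), sub_sub_cancel]

lemma tendsto_arccot_atTop : Tendsto arccot atTop (𝓝[>] 0) := by
  refine tendsto_nhdsWithin_iff.2 ⟨?_, .of_forall fun x => (arccot_mem_Ioo x).1⟩
  have h := (tendsto_nhds_of_tendsto_nhdsWithin Real.tendsto_arctan_atTop).const_sub (Real.pi / 2)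
  rwa [sub_self] at h

lemma tendsto_arccot_atBot : Tendsto arccot atBot (𝓝[<] Real.pi) := by
  refine tendsto_nhdsWithin_iff.2 ⟨?_, .of_forall fun x => (arccot_mem_Ioo x).2⟩
  have h := (tendsto_nhds_of_tendsto_nhdsWithin Real.tendsto_arctan_atBot).const_sub (Real.pi / 2)
  rwa [sub_neg_eq_add, add_halves] at h

/-- The angle whose cotangent is `cot s + y`: the angular position of the point at signed distance
`y` from `cot s`. -/
noncomputable def shiftedAngle (s y : ℝ) : ℝ := arccot (Real.cot s + y)

lemma shiftedAngle_zero {s : ℝ} (hs : s ∈ Set.Ioo 0 Real.pi) : shiftedAngle s 0 = s := by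
  rw [shiftedAngle, add_zero, arccot_cot hs]

lemma hasDerivAt_shiftedAngle (s y : ℝ) :
    HasDerivAt (shiftedAngle s) (-Real.sin (shiftedAngle s y) ^ 2) y :=
  (hasDerivAt_arccot _).comp_const_add _ _

lemma tendsto_shiftedAngle_atTop (s : ℝ) : Tendsto (shiftedAngle s) atTop (𝓝[>] 0) :=
  tendsto_arccot_atTop.comp (tendsto_atTop_add_const_left _ _ tendsto_id)

lemma tendsto_shiftedAngle_atBot (s : ℝ) : Tendsto (shiftedAngle s) atBot (𝓝[<] Real.pi) :=
  tendsto_arccot_atBot.comp (tendsto_atBot_add_const_left _ _ tendsto_id)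

lemma sin_shiftedAngle_sub {s : ℝ} (hs : Real.sin s ≠ 0) (y : ℝ) :
    Real.sin (shiftedAngle s y - s) = -(y * Real.sin (shiftedAngle s y) * Real.sin s) := by
  rw [shiftedAngle, Real.sin_sub, cos_arccot, Real.cot_eq_cos_div_sin]
  field_simp
  ring

lemma hasDerivAt_comp_shiftedAngle {U G : ℝ → ℝ} {s y : ℝ} (hs : Real.sin s ≠ 0) (hy : y ≠ 0)
    (hG : ∀ θ ∈ Set.Ioo 0 Real.pi, θ ≠ s →
      HasDerivAt G ((U s - U θ) / Real.sin (θ - s) ^ 2) θ) :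
    HasDerivAt (fun y => -Real.sin s ^ 2 * G (shiftedAngle s y))
      ((U s - U (shiftedAngle s y)) / y ^ 2) y := by
  have hsin : Real.sin (shiftedAngle s y) ≠ 0 := (sin_arccot_pos _).ne'
  have hsub := sin_shiftedAngle_sub hs y
  have hne : shiftedAngle s y ≠ s := fun h => by simp [h, hs, hy] at hsub
  refine (((hG _ (arccot_mem_Ioo _) hne).comp y
    (hasDerivAt_shiftedAngle s y)).const_mul _).congr_deriv ?_
  change -Real.sin s ^ 2 * ((U s - U (shiftedAngle s y)) / Real.sin (shiftedAngle s y - s) ^ 2 *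
    -Real.sin (shiftedAngle s y) ^ 2) = _
  rw [hsub]
  field_simp

lemma tendsto_log_sub_log_of_hasDerivAt {f : ℝ → ℝ} {f' x : ℝ} (hf : HasDerivAt f f' x)
    (hf' : f' ≠ 0) :
    Tendsto (fun y => Real.log (f y - f x) - Real.log (y - x)) (𝓝[≠] x) (𝓝 (Real.log f')) := by
  refine ((Real.continuousAt_log hf').tendsto.comp hf.tendsto_slope).congr' ?_
  filter_upwards [self_mem_nhdsWithin, hf.eventually_ne hf'] with y hy hfy
  rw [Function.comp_apply, slope_def_field,
    Real.log_div (sub_ne_zero.2 hfy) (sub_ne_zero.2 hy)]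

lemma tendsto_comp_sub_log_of_hasDerivAt {G f : ℝ → ℝ} {b c f' x : ℝ} (hf : HasDerivAt f f' x)
    (hf' : f' ≠ 0) (hG : Tendsto (fun t => G t - c * Real.log (t - f x)) (𝓝[≠] f x) (𝓝 b)) :
    Tendsto (fun y => G (f y) - c * Real.log (y - x)) (𝓝[≠] x) (𝓝 (b + c * Real.log f')) := by
  refine ((hG.comp (hf.tendsto_nhdsNE hf')).add
    ((tendsto_log_sub_log_of_hasDerivAt hf hf').const_mul c)).congr fun y => ?_
  simp only [Function.comp_apply]
  ring

-- The logarithm is even, so its contributions at `-ε` and `ε` cancel.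
lemma tendsto_neg_sub_of_tendsto_sub_log {F : ℝ → ℝ} {b c : ℝ}
    (h : Tendsto (fun y => F y - c * Real.log y) (𝓝[≠] 0) (𝓝 b)) :
    Tendsto (fun ε => F (-ε) - F ε) (𝓝[>] 0) (𝓝 0) := by
  have hpos : Tendsto (fun ε : ℝ => ε) (𝓝[>] 0) (𝓝[≠] 0) :=
    tendsto_id.mono_left (nhdsGT_le_nhdsNE 0)
  have hneg : Tendsto (fun ε : ℝ => -ε) (𝓝[>] 0) (𝓝[≠] 0) := by
    simpa only [neg_zero] using (tendsto_neg_nhdsGT (a := (0 : ℝ))).mono_right (nhdsLT_le_nhdsNE _)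
  simpa [Function.comp_def] using (h.comp hneg).sub (h.comp hpos)

lemma hasHalfLaplacianS_one_of_hasDerivAt {U G : ℝ → ℝ} {s A B b c : ℝ}
    (hs : s ∈ Set.Ioo 0 Real.pi) (hU : ContinuousOn U (Set.Icc 0 Real.pi))
    (hG : ∀ θ ∈ Set.Ioo 0 Real.pi, θ ≠ s →
      HasDerivAt G ((U s - U θ) / Real.sin (θ - s) ^ 2) θ)
    (hA : Tendsto G (𝓝[>] 0) (𝓝 A)) (hB : Tendsto G (𝓝[<] Real.pi) (𝓝 B))
    (hlog : Tendsto (fun θ => G θ - c * Real.log (θ - s)) (𝓝[≠] s) (𝓝 b)) :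
    HasHalfLaplacianS 1 U s (Real.sin s ^ 2 / Real.pi * (B - A)) := by
  have hsin : Real.sin s ≠ 0 := (Real.sin_pos_of_mem_Ioo hs).ne'
  have hmaps (x : ℝ) : arccot x ∈ Set.Icc 0 Real.pi := Set.Ioo_subset_Icc_self (arccot_mem_Ioo x)
  have hcont : Continuous (U ∘ arccot) := hU.comp_continuous continuous_arccot hmaps
  obtain ⟨C, hC⟩ := isCompact_Icc.exists_bound_of_continuousOn hU
  let F (y : ℝ) : ℝ := -Real.sin s ^ 2 * G (shiftedAngle s y)
  have hF : ∀ y ≠ 0, HasDerivAt F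
      (((U ∘ arccot) (Real.cot s) - (U ∘ arccot) (Real.cot s + y)) / |y| ^ (1 + (1 : ℝ))) y := by
    intro y hy
    simpa only [Function.comp_apply, arccot_cot hs, one_add_one_eq_two, Real.rpow_two, sq_abs,
      shiftedAngle, F] using hasDerivAt_comp_shiftedAngle hsin hy hG
  have hcancel : Tendsto (fun ε => F (-ε) - F ε) (𝓝[>] 0) (𝓝 0) := by
    have hangle := hasDerivAt_shiftedAngle s 0
    rw [← shiftedAngle_zero hs] at hlog
    have hsing := tendsto_comp_sub_log_of_hasDerivAt hangle (by simp [shiftedAngle_zero hs, hsin])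
      hlog
    simp only [sub_zero] at hsing
    simpa only [mul_sub, mul_zero] using
      (tendsto_neg_sub_of_tendsto_sub_log hsing).const_mul (-Real.sin s ^ 2)
  have hfrac := hasFracLaplacianAt_of_hasDerivAt one_pos hcont.measurable (fun t => hC _ (hmaps t))
    hF ((hA.comp (tendsto_shiftedAngle_atTop s)).const_mul _)
    ((hB.comp (tendsto_shiftedAngle_atBot s)).const_mul _) hcancel
  rw [HasHalfLaplacianS, one_mul]
  convert hfrac using 1
  · simp only [div_one, Function.comp_def]
  · rw [fracLaplConst_one]
    ring

lemma cot_add_pi (s : ℝ) : Real.cot (s + Real.pi) = Real.cot s := by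
  simp only [← Real.tan_inv_eq_cot, Real.tan_add_pi]

lemma hasHalfLaplacianS_add_pi_iff {L : ℝ} {U : ℝ → ℝ} {s v : ℝ} :
    HasHalfLaplacianS L U (s + Real.pi) v ↔ HasHalfLaplacianS L U s v := by
  simp only [HasHalfLaplacianS, cot_add_pi]

lemma hasDerivAt_tan_half {x : ℝ} (hx : Real.cos (x / 2) ≠ 0) :
    HasDerivAt (fun x => Real.tan (x / 2)) (1 / (2 * Real.cos (x / 2) ^ 2)) x := by
  refine (HasDerivAt.comp x (Real.hasDerivAt_tan hx)
    ((hasDerivAt_id' x).div_const 2)).congr_deriv ?_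
  ring

lemma hasDerivAt_log_tan_half {x : ℝ} (hx : Real.sin x ≠ 0) :
    HasDerivAt (fun x => Real.log (Real.tan (x / 2))) (1 / Real.sin x) x := by
  have hsin_two : Real.sin x = 2 * Real.sin (x / 2) * Real.cos (x / 2) := by
    rw [← Real.sin_two_mul, mul_div_cancel₀ x two_ne_zero]
  have hsin : Real.sin (x / 2) ≠ 0 := fun h => hx (by rw [hsin_two, h]; ring)
  have hcos : Real.cos (x / 2) ≠ 0 := fun h => hx (by rw [hsin_two, h]; ring)
  have htan : Real.tan (x / 2) ≠ 0 := by
    rw [Real.tan_eq_sin_div_cos]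
    exact div_ne_zero hsin hcos
  refine ((hasDerivAt_tan_half hcos).log htan).congr_deriv ?_
  rw [Real.tan_eq_sin_div_cos, hsin_two]
  field_simp

lemma tendsto_div_of_hasDerivAt {𝕜 𝕜' : Type*} [NontriviallyNormedField 𝕜] [NormedField 𝕜']
    [NormedAlgebra 𝕜 𝕜'] {f g : 𝕜 → 𝕜'} {f' g' : 𝕜'} {x : 𝕜} (hf : HasDerivAt f f' x)
    (hg : HasDerivAt g g' x) (hfx : f x = 0) (hgx : g x = 0) (hg' : g' ≠ 0) :
    Tendsto (fun y => f y / g y) (𝓝[≠] x) (𝓝 (f' / g')) := by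
  refine (hf.tendsto_slope.div hg.tendsto_slope hg').congr' ?_
  filter_upwards [self_mem_nhdsWithin] with y hy
  have hyx : (y - x)⁻¹ ≠ 0 := inv_ne_zero (sub_ne_zero.2 hy)
  simp only [slope_def_module, hfx, hgx, sub_zero, Pi.div_apply]
  rw [Algebra.smul_def, Algebra.smul_def,
    mul_div_mul_left _ _ ((map_ne_zero (algebraMap 𝕜 𝕜')).2 hyx)]

/-- The partial sums of `artanh (e ^ (i z))`, through which the primitive below accounts for the
oscillation of the odd frequencies. -/
noncomputable def oddExpSum (N : ℕ) (z : ℂ) : ℂ :=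
  ∑ j ∈ Finset.range N, Complex.exp (z * Complex.I) ^ (2 * j + 1) / (2 * j + 1)

lemma hasDerivAt_exp_mul_I_pow (n : ℕ) (z : ℂ) :
    HasDerivAt (fun z => Complex.exp (z * Complex.I) ^ n)
      (n * Complex.I * Complex.exp (z * Complex.I) ^ n) z := by
  simp only [← Complex.exp_nat_mul]
  refine (((hasDerivAt_mul_const Complex.I).const_mul (n : ℂ)).cexp).congr_deriv ?_
  ring

lemma two_I_mul_sin_mul_exp (z : ℂ) :
    2 * Complex.I * Complex.sin z * Complex.exp (z * Complex.I) =
      Complex.exp (z * Complex.I) ^ 2 - 1 := by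
  rw [Complex.exp_mul_I]
  linear_combination (Complex.sin z ^ 2) * Complex.I_sq - Complex.sin_sq_add_cos_sq z

lemma two_cos_mul_exp (z : ℂ) :
    2 * Complex.cos z * Complex.exp (z * Complex.I) = Complex.exp (z * Complex.I) ^ 2 + 1 := by
  rw [Complex.exp_mul_I]
  linear_combination Complex.sin_sq_add_cos_sq z - (Complex.sin z ^ 2) * Complex.I_sq

lemma hasDerivAt_oddExpSum (N : ℕ) {z : ℂ} (hz : Complex.sin z ≠ 0) :
    HasDerivAt (oddExpSum N)
      ((Complex.exp (z * Complex.I) ^ (2 * N) - 1) / (2 * Complex.sin z)) z := by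
  induction N with
  | zero =>
    have hzero : oddExpSum 0 = fun _ => 0 := funext fun z => Finset.sum_range_zero _
    simpa only [hzero, mul_zero, pow_zero, sub_self, zero_div] using hasDerivAt_const z (0 : ℂ)
  | succ N ih =>
    have hN : 2 * (N : ℂ) + 1 ≠ 0 := by exact_mod_cast (2 * N).succ_ne_zero
    have hterm := (hasDerivAt_exp_mul_I_pow (2 * N + 1) z).div_const (2 * N + 1)
    have hsucc : oddExpSum (N + 1) = fun z =>
        oddExpSum N z + Complex.exp (z * Complex.I) ^ (2 * N + 1) / (2 * N + 1) :=
      funext fun z => Finset.sum_range_succ _ _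
    rw [hsucc]
    refine (ih.add hterm).congr_deriv ?_
    push_cast
    field_simp
    linear_combination Complex.exp (z * Complex.I) ^ (2 * N) * two_I_mul_sin_mul_exp z

/-- A primitive of `φ ↦ (1 - e ^ (i (2m+1) φ)) / sin² φ`. The term `log (tan (φ / 2))` stands for
`log |tan (φ / 2)|`, since `Real.log` is even. -/
noncomputable def sinSqKernelPrimitive (m : ℕ) (φ : ℝ) : ℂ :=
  (Complex.exp (φ * Complex.I) ^ (2 * m + 2) - Complex.cos φ) / Complex.sin φ
    - (2 * m + 1) * Complex.I * (Real.log (Real.tan (φ / 2)) + 2 * oddExpSum (m + 1) φ)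

lemma hasDerivAt_sinSqKernelPrimitive (m : ℕ) {φ : ℝ} (hφ : Real.sin φ ≠ 0) :
    HasDerivAt (sinSqKernelPrimitive m)
      ((1 - Complex.exp (φ * Complex.I) ^ (2 * m + 1)) / Complex.sin φ ^ 2) φ := by
  have hsin : Complex.sin φ ≠ 0 := by exact_mod_cast hφ
  have hfrac := ((((hasDerivAt_exp_mul_I_pow (2 * m + 2) φ).sub (Complex.hasDerivAt_cos φ)).div
    (Complex.hasDerivAt_sin φ) hsin)).comp_ofReal
  have hlog := (hasDerivAt_log_tan_half hφ).ofReal_comp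
  have hsum := (hasDerivAt_oddExpSum (m + 1) hsin).comp_ofReal
  refine (hfrac.sub ((hlog.add (hsum.const_mul 2)).const_mul
    ((2 * m + 1) * Complex.I))).congr_deriv ?_
  have hcosexp := two_cos_mul_exp φ
  have hsinexp := two_I_mul_sin_mul_exp φ
  push_cast
  rw [Pi.sub_apply]
  generalize Complex.exp (φ * Complex.I) = z at *
  field_simp
  linear_combination Complex.sin_sq_add_cos_sq φ + z ^ (2 * m + 1) / 2 * (hsinexp - hcosexp)

lemma tendsto_sinSqKernelPrimitive_sub_log (m : ℕ) :
    ∃ b, Tendsto (fun φ => sinSqKernelPrimitive m φ + (2 * m + 1) * Complex.I * Real.log φ)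
      (𝓝[≠] 0) (𝓝 b) := by
  have hnum : HasDerivAt (fun φ : ℝ =>
      Complex.exp (φ * Complex.I) ^ (2 * m + 2) - Complex.cos φ) (_ : ℂ) 0 :=
    ((hasDerivAt_exp_mul_I_pow (2 * m + 2) 0).sub (Complex.hasDerivAt_cos 0)).comp_ofReal (z := 0)
  have hden : HasDerivAt (fun φ : ℝ => Complex.sin φ) (_ : ℂ) 0 :=
    (Complex.hasDerivAt_sin 0).comp_ofReal (z := 0)
  have hfrac := tendsto_div_of_hasDerivAt hnum hden (by simp) (by simp) (by simp)
  have hlog := tendsto_log_sub_log_of_hasDerivAt (hasDerivAt_tan_half (x := 0) (by simp)) (by simp)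
  have hsum : Continuous fun φ : ℝ => oddExpSum (m + 1) φ := by
    unfold oddExpSum
    fun_prop
  refine ⟨_, (hfrac.sub ((((Complex.continuous_ofReal.tendsto _).comp hlog).add
    ((hsum.tendsto 0).mono_left nhdsWithin_le_nhds |>.const_mul 2)).const_mul
      ((2 * m + 1) * Complex.I))).congr fun φ => ?_⟩
  simp only [sinSqKernelPrimitive, Function.comp_apply, zero_div, Real.tan_zero, sub_zero,
    Complex.ofReal_sub]
  ring

lemma one_sub_sq_mul_sum_pow_div_odd {K : Type*} [Field K] [CharZero K] (v : K) (N : ℕ) :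
    (1 - v) ^ 2 * ∑ j ∈ Finset.range N, v ^ j / (2 * j + 1) =
      1 + v + 8 * v * ∑ n ∈ Finset.range N, v ^ n / ((2 * n - 1) * (2 * n + 1) * (2 * n + 3))
        - v ^ N / (2 * N + 1) + v ^ (N + 1) / (2 * N - 1) := by
  induction N with
  | zero => norm_num [div_neg]
  | succ N ih =>
    have h1 : 2 * (N : K) + 1 ≠ 0 := by exact_mod_cast (2 * N).succ_ne_zero
    have h3 : 2 * (N : K) + 3 ≠ 0 := by exact_mod_cast (2 * N + 2).succ_ne_zero
    have hm1 : 2 * (N : K) - 1 ≠ 0 := by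
      rw [sub_ne_zero]
      exact_mod_cast (show 2 * N ≠ 1 by omega)
    rw [Finset.sum_range_succ, Finset.sum_range_succ, mul_add, ih]
    push_cast
    rw [show 2 * ((N : K) + 1) + 1 = 2 * N + 3 by ring,
      show 2 * ((N : K) + 1) - 1 = 2 * N + 1 by ring]
    field_simp
    ring

lemma tan_pi_sub_div_two (s : ℝ) : Real.tan ((Real.pi - s) / 2) = Real.cot (s / 2) := by
  rw [sub_div, Real.tan_pi_div_two_sub, Real.tan_inv_eq_cot]

lemma log_tan_neg_div_two (s : ℝ) :
    Real.log (Real.tan (-s / 2)) = -Real.log (Real.cot (s / 2)) := by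
  rw [neg_div, Real.tan_neg, Real.log_neg_eq_log, ← Real.tan_inv_eq_cot, Real.log_inv, neg_neg]

lemma exp_pi_sub_mul_I (z : ℂ) :
    Complex.exp ((Real.pi - z) * Complex.I) = -Complex.exp (-z * Complex.I) := by
  rw [sub_mul, sub_eq_add_neg, ← neg_mul, Complex.exp_add, Complex.exp_pi_mul_I, neg_one_mul]

lemma oddExpSum_pi_sub (N : ℕ) (z : ℂ) : oddExpSum N (Real.pi - z) = -oddExpSum N (-z) := by
  simp only [oddExpSum, exp_pi_sub_mul_I, (odd_two_mul_add_one _).neg_pow, neg_div,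
    Finset.sum_neg_distrib]

lemma sinSqKernelPrimitive_pi_sub_sub_neg (m : ℕ) (s : ℝ) :
    sinSqKernelPrimitive m (Real.pi - s) - sinSqKernelPrimitive m (-s) =
      2 * Complex.exp (-s * Complex.I) ^ (2 * m + 2) / Complex.sin s
        - 2 * (2 * m + 1) * Complex.I *
          (Real.log (Real.cot (s / 2)) - 2 * oddExpSum (m + 1) (-s)) := by
  simp only [sinSqKernelPrimitive, tan_pi_sub_div_two, log_tan_neg_div_two, Complex.ofReal_sub,
    Complex.ofReal_neg, oddExpSum_pi_sub, exp_pi_sub_mul_I, Complex.cos_pi_sub, Complex.sin_pi_sub,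
    Complex.cos_neg, Complex.sin_neg, (even_two_mul (m + 1)).neg_pow, ← mul_add_one, div_neg]
  ring

/-- The closed form `E` for which the half Laplacian of `t ↦ e ^ (i k t)` at `s` is
`-(2 i / π) E`, when `k` is odd. -/
noncomputable def oddClosedForm (k : ℕ) (s : ℝ) : ℂ :=
  1 / (k + 2)
    + k * Complex.exp (k * s * Complex.I) *
      (Real.cos s + Real.sin s ^ 2 * Real.log |Real.cot (s / 2)|)
    + 4 * k * ∑ n ∈ Finset.range ((k - 1) / 2 + 1),
      Complex.exp ((k - 1 - 2 * n) * s * Complex.I) /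
        ((2 * n - 1) * (2 * n + 1) * (2 * n + 3))

lemma oddExpSum_eq_exp_mul_sum (N : ℕ) (z : ℂ) :
    oddExpSum N z = Complex.exp (z * Complex.I) *
      ∑ j ∈ Finset.range N, (Complex.exp (z * Complex.I) ^ 2) ^ j / (2 * j + 1) := by
  rw [oddExpSum, Finset.mul_sum]
  refine Finset.sum_congr rfl fun j _ => ?_
  rw [← pow_mul, pow_succ']
  ring

lemma exp_natCast_mul_mul_I (k : ℕ) (z : ℂ) :
    Complex.exp (k * z * Complex.I) = Complex.exp (z * Complex.I) ^ k := by
  rw [mul_assoc, Complex.exp_nat_mul]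

lemma exp_sub_two_mul_mul_I (m n : ℕ) (s : ℂ) :
    Complex.exp (((2 * m + 1 : ℕ) - 1 - 2 * n) * s * Complex.I) =
      Complex.exp (s * Complex.I) ^ (2 * m) * (Complex.exp (-s * Complex.I) ^ 2) ^ n := by
  rw [← pow_mul, ← Complex.exp_nat_mul, ← Complex.exp_nat_mul, ← Complex.exp_add]
  push_cast
  ring_nf

lemma four_mul_sin_sq_mul_oddExpSum_neg (m : ℕ) (s : ℂ) :
    4 * Complex.sin s ^ 2 * (Complex.exp (s * Complex.I) ^ (2 * m + 1) * oddExpSum (m + 1) (-s)) =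
      1 / (2 * m + 3) - Complex.exp (-s * Complex.I) ^ 2 / (2 * m + 1)
        - 2 * Complex.cos s * Complex.exp (s * Complex.I) ^ (2 * m + 1)
        - 8 * ∑ n ∈ Finset.range (m + 1),
          Complex.exp (((2 * m + 1 : ℕ) - 1 - 2 * n) * s * Complex.I) /
            ((2 * n - 1) * (2 * n + 1) * (2 * n + 3)) := by
  have hsum := one_sub_sq_mul_sum_pow_div_odd (Complex.exp (-s * Complex.I) ^ 2) (m + 1)
  have hcos := two_cos_mul_exp s
  have hsin := two_I_mul_sin_mul_exp (-s)
  have hinv : Complex.exp (s * Complex.I) * Complex.exp (-s * Complex.I) = 1 := by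
    rw [← Complex.exp_add, neg_mul, add_neg_cancel, Complex.exp_zero]
  simp only [exp_sub_two_mul_mul_I, mul_div_assoc, ← Finset.mul_sum, oddExpSum_eq_exp_mul_sum]
  generalize Complex.exp (s * Complex.I) = z, Complex.exp (-s * Complex.I) = w at *
  rw [Complex.sin_neg] at hsin
  have hsq : 4 * Complex.sin s ^ 2 = -(z ^ 2 * (1 - w ^ 2) ^ 2) := by
    have hsub : 2 * Complex.I * Complex.sin s = z * (1 - w ^ 2) := by
      linear_combination -z * hsin - 2 * Complex.I * Complex.sin s * hinv
    linear_combination (-2 * Complex.I * Complex.sin s - z * (1 - w ^ 2)) * hsub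
      + 4 * Complex.sin s ^ 2 * Complex.I_sq
  have hpow : z ^ (2 * m + 2) * w ^ (2 * m + 2) = 1 := by rw [← mul_pow, hinv, one_pow]
  push_cast at hsum
  generalize ∑ j ∈ Finset.range (m + 1), (w ^ 2) ^ j / (2 * (j : ℂ) + 1) = S at *
  generalize ∑ n ∈ Finset.range (m + 1),
    (w ^ 2) ^ n / ((2 * (n : ℂ) - 1) * (2 * n + 1) * (2 * n + 3)) = T at *
  linear_combination z ^ (2 * m + 1) * w * S * hsq - z ^ (2 * m + 2) * hsum
    + (1 / (2 * m + 3) - w ^ 2 / (2 * m + 1)) * hpow + z ^ (2 * m) * hcos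
    - (z ^ (2 * m + 2) * (1 - w ^ 2) ^ 2 * S + (z * w + 1) * (1 + 8 * T) * z ^ (2 * m)) * hinv

lemma sin_sq_mul_sinSqKernelPrimitive_sub (m : ℕ) (s : ℝ) :
    Complex.sin s ^ 2 * (Complex.exp (s * Complex.I) ^ (2 * m + 1) *
      (sinSqKernelPrimitive m (Real.pi - s) - sinSqKernelPrimitive m (-s))) =
      -2 * Complex.I * oddClosedForm (2 * m + 1) s := by
  have hsum := four_mul_sin_sq_mul_oddExpSum_neg m s
  have hsin := two_I_mul_sin_mul_exp (-s)
  have hinv : Complex.exp (s * Complex.I) * Complex.exp (-s * Complex.I) = 1 := by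
    rw [← Complex.exp_add, neg_mul, add_neg_cancel, Complex.exp_zero]
  rw [sinSqKernelPrimitive_pi_sub_sub_neg, oddClosedForm, exp_natCast_mul_mul_I, Real.log_abs,
    Nat.add_sub_cancel, Nat.mul_div_cancel_left m two_pos]
  have hpow : Complex.exp (s * Complex.I) ^ (2 * m + 1) * Complex.exp (-s * Complex.I) ^ (2 * m + 2)
      = Complex.exp (-s * Complex.I) := by
    rw [pow_succ (Complex.exp (-s * Complex.I)), ← mul_assoc, ← mul_pow, hinv, one_pow, one_mul]
  have hcancel : Complex.sin s ^ 2 / Complex.sin s = Complex.sin s := by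
    rw [sq, mul_self_div_self]
  have hfrac : (2 * (m : ℂ) + 1) *
      (1 / (2 * m + 3) - Complex.exp (-s * Complex.I) ^ 2 / (2 * m + 1)) =
        1 - 2 / (2 * m + 3) - Complex.exp (-s * Complex.I) ^ 2 := by
    have hk : 2 * (m : ℂ) + 1 ≠ 0 := by exact_mod_cast (2 * m).succ_ne_zero
    have hk2 : 2 * (m : ℂ) + 3 ≠ 0 := by exact_mod_cast (2 * m + 2).succ_ne_zero
    field_simp
    ring
  rw [Complex.sin_neg] at hsin
  push_cast at hsum ⊢
  rw [show 2 * (m : ℂ) + 1 + 2 = 2 * m + 3 by ring]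
  linear_combination 2 * (Complex.sin s ^ 2 / Complex.sin s) * hpow
    + 2 * Complex.exp (-s * Complex.I) * hcancel + Complex.I * hsin
    + (2 * m + 1) * Complex.I * hsum + Complex.I * hfrac
    + 2 * Complex.sin s * Complex.exp (-s * Complex.I) * Complex.I_sq

lemma oddClosedForm_eq_mk (k : ℕ) (s : ℝ) :
    oddClosedForm k s =
      ⟨1 / (k + 2)
        + k * Real.cos (k * s) * (Real.cos s + Real.sin s ^ 2 * Real.log |Real.cot (s / 2)|)
        + 4 * k * ∑ n ∈ Finset.range ((k - 1) / 2 + 1),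
          Real.cos ((k - 1 - 2 * n) * s) / ((2 * n - 1) * (2 * n + 1) * (2 * n + 3)),
      k * Real.sin (k * s) * (Real.cos s + Real.sin s ^ 2 * Real.log |Real.cot (s / 2)|)
        + 4 * k * ∑ n ∈ Finset.range ((k - 1) / 2 + 1),
          Real.sin ((k - 1 - 2 * n) * s) / ((2 * n - 1) * (2 * n + 1) * (2 * n + 3))⟩ := by
  simp only [oddClosedForm, Complex.mk_eq_add_mul_I, Complex.exp_mul_I, add_div,
    mul_div_right_comm _ Complex.I, Finset.sum_add_distrib, ← Finset.sum_mul]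
  push_cast
  ring

lemma neg_two_I_div_pi_mul (z : ℂ) :
    -(2 * Complex.I / Real.pi) * z = ⟨2 / Real.pi * z.im, -(2 / Real.pi * z.re)⟩ := by
  rw [Complex.mk_eq_add_mul_I]
  nth_rw 1 [← Complex.re_add_im z]
  push_cast
  linear_combination (-(2 * z.im / Real.pi) : ℂ) * Complex.I_sq

lemma exp_add_pi_mul_I (z : ℂ) :
    Complex.exp ((z + Real.pi) * Complex.I) = -Complex.exp (z * Complex.I) := by
  rw [add_mul]
  exact Complex.exp_antiperiodic _

lemma log_abs_cot_add_pi_div_two (s : ℝ) :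
    Real.log |Real.cot ((s + Real.pi) / 2)| = -Real.log |Real.cot (s / 2)| := by
  rw [← Real.tan_inv_eq_cot (s / 2), abs_inv, Real.log_inv, neg_neg, add_div,
    Real.cot_eq_cos_div_sin, Real.cos_add_pi_div_two, Real.sin_add_pi_div_two, neg_div, abs_neg,
    Real.tan_eq_sin_div_cos]

lemma oddClosedForm_add_pi (m : ℕ) (s : ℝ) :
    oddClosedForm (2 * m + 1) (s + Real.pi) = oddClosedForm (2 * m + 1) s := by
  have hneg : Complex.exp (-(s + Real.pi) * Complex.I) = -Complex.exp (-s * Complex.I) := by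
    rw [neg_mul, Complex.exp_neg, exp_add_pi_mul_I, inv_neg, ← Complex.exp_neg, neg_mul]
  simp only [oddClosedForm, Complex.ofReal_add, exp_sub_two_mul_mul_I, exp_natCast_mul_mul_I,
    exp_add_pi_mul_I, hneg, Real.cos_add_pi, Real.sin_add_pi, log_abs_cot_add_pi_div_two,
    even_two.neg_pow, (even_two_mul m).neg_pow, (odd_two_mul_add_one m).neg_pow]
  push_cast
  ring

lemma hasDerivAt_exp_pow_mul_sinSqKernelPrimitive_sub (m : ℕ) {s θ : ℝ}
    (hθ : Real.sin (θ - s) ≠ 0) :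
    HasDerivAt (fun θ : ℝ =>
        Complex.exp (s * Complex.I) ^ (2 * m + 1) * sinSqKernelPrimitive m (θ - s))
      (((Real.sin (θ - s) ^ 2)⁻¹ : ℝ) • (Complex.exp (s * Complex.I) ^ (2 * m + 1) -
        Complex.exp (θ * Complex.I) ^ (2 * m + 1))) θ := by
  refine (((hasDerivAt_sinSqKernelPrimitive m hθ).comp_sub_const θ s).const_mul _).congr_deriv ?_
  have hexp : Complex.exp (s * Complex.I) * Complex.exp ((θ - s : ℝ) * Complex.I) =
      Complex.exp (θ * Complex.I) := by
    rw [← Complex.exp_add, ← add_mul, ← Complex.ofReal_add, add_sub_cancel]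
  rw [Complex.real_smul, ← hexp, mul_pow]
  push_cast
  ring

lemma sin_sub_ne_zero {s θ : ℝ} (hs : s ∈ Set.Ioo 0 Real.pi) (hθ : θ ∈ Set.Ioo 0 Real.pi)
    (hne : θ ≠ s) : Real.sin (θ - s) ≠ 0 := by
  have hlower : -Real.pi < θ - s := by linarith [hθ.1, hs.2]
  have hupper : θ - s < Real.pi := by linarith [hθ.2, hs.1]
  exact mt (Real.sin_eq_zero_iff_of_lt_of_lt hlower hupper).1 (sub_ne_zero.2 hne)

lemma hasHalfLaplacianS_clm_exp_of_mem_Ioo (g : ℂ →L[ℝ] ℝ) (m : ℕ) {s : ℝ}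
    (hs : s ∈ Set.Ioo 0 Real.pi) :
    HasHalfLaplacianS 1 (fun t => g (Complex.exp ((2 * m + 1 : ℕ) * t * Complex.I))) s
      (g (-(2 * Complex.I / Real.pi) * oddClosedForm (2 * m + 1) s)) := by
  simp only [exp_natCast_mul_mul_I]
  let w (θ : ℝ) : ℂ := Complex.exp (θ * Complex.I) ^ (2 * m + 1)
  let G (θ : ℝ) : ℝ := g (w s * sinSqKernelPrimitive m (θ - s))
  have hderiv {θ : ℝ} (hθ : Real.sin (θ - s) ≠ 0) :
      HasDerivAt G ((g (w s) - g (w θ)) / Real.sin (θ - s) ^ 2) θ := by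
    refine (g.hasFDerivAt.comp_hasDerivAt θ
      (hasDerivAt_exp_pow_mul_sinSqKernelPrimitive_sub m hθ)).congr_deriv ?_
    rw [map_smul, map_sub, smul_eq_mul, inv_mul_eq_div]
  obtain ⟨b, hb⟩ := tendsto_sinSqKernelPrimitive_sub_log m
  have hlog : Tendsto (fun θ => G θ - g (-(w s * ((2 * m + 1) * Complex.I))) * Real.log (θ - s))
      (𝓝[≠] s) (𝓝 (g (w s * b))) := by
    have hshift : Tendsto (fun θ => θ - s) (𝓝[≠] s) (𝓝[≠] 0) := by
      simpa only [sub_self] using ((hasDerivAt_id' s).sub_const s).tendsto_nhdsNE one_ne_zero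
    refine ((g.continuous.tendsto _).comp ((hb.comp hshift).const_mul (w s))).congr fun θ => ?_
    rw [mul_comm (g _), ← smul_eq_mul (a := Real.log (θ - s)), ← map_smul, ← map_sub,
      Complex.real_smul]
    refine congrArg g ?_
    simp only [Function.comp_apply]
    ring
  have hsin : Real.sin s ≠ 0 := (Real.sin_pos_of_mem_Ioo hs).ne'
  have hzero : ContinuousAt G 0 := (hderiv (by simpa using hsin)).continuousAt
  have hpi : ContinuousAt G Real.pi := (hderiv (by simpa using hsin)).continuousAt
  have hvalue : Real.sin s ^ 2 / Real.pi * (G Real.pi - G 0) =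
      g (-(2 * Complex.I / Real.pi) * oddClosedForm (2 * m + 1) s) := by
    rw [← map_sub, ← smul_eq_mul, ← map_smul, ← mul_sub, zero_sub, Complex.real_smul]
    congr 1
    push_cast
    linear_combination (1 / Real.pi : ℂ) * sin_sq_mul_sinSqKernelPrimitive_sub m s
  rw [← hvalue]
  exact hasHalfLaplacianS_one_of_hasDerivAt (U := fun θ => g (w θ)) hs (by fun_prop)
    (fun θ hθ hθs => hderiv (sin_sub_ne_zero hs hθ hθs))
    (hzero.mono_left nhdsWithin_le_nhds) (hpi.mono_left nhdsWithin_le_nhds) hlog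

lemma hasHalfLaplacianS_clm_exp (g : ℂ →L[ℝ] ℝ) (m : ℕ) {s : ℝ}
    (hs : s ∈ Set.Ioo (-Real.pi) 0 ∪ Set.Ioo 0 Real.pi) :
    HasHalfLaplacianS 1 (fun t => g (Complex.exp ((2 * m + 1 : ℕ) * t * Complex.I))) s
      (g (-(2 * Complex.I / Real.pi) * oddClosedForm (2 * m + 1) s)) := by
  rcases hs with hs | hs
  · rw [← hasHalfLaplacianS_add_pi_iff, ← oddClosedForm_add_pi]
    exact hasHalfLaplacianS_clm_exp_of_mem_Ioo g m
      ⟨by linarith [hs.1], by linarith [hs.2]⟩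
  · exact hasHalfLaplacianS_clm_exp_of_mem_Ioo g m hs

theorem mainTheorem5 (k : ℕ) (hk : Odd k) (s : ℝ)
    (hs : s ∈ Set.Ioo (-Real.pi) 0 ∪ Set.Ioo 0 Real.pi) :
    HasHalfLaplacianS 1 (fun t : ℝ => Real.cos ((k : ℝ) * t)) s
      (2 * (k : ℝ) / Real.pi * Real.sin ((k : ℝ) * s) *
          (Real.cos s + Real.sin s ^ 2 * Real.log |Real.cot (s / 2)|)
        + 8 * (k : ℝ) / Real.pi *
          ∑ n ∈ Finset.range ((k - 1) / 2 + 1),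
            Real.sin (((k : ℝ) - 1 - 2 * (n : ℝ)) * s) /
              ((2 * (n : ℝ) - 1) * (2 * (n : ℝ) + 1) * (2 * (n : ℝ) + 3))) ∧
    HasHalfLaplacianS 1 (fun t : ℝ => Real.sin ((k : ℝ) * t)) s
      (-(2 / (Real.pi * ((k : ℝ) + 2)))
        - 2 * (k : ℝ) / Real.pi * Real.cos ((k : ℝ) * s) *
          (Real.cos s + Real.sin s ^ 2 * Real.log |Real.cot (s / 2)|)
        - 8 * (k : ℝ) / Real.pi *
          ∑ n ∈ Finset.range ((k - 1) / 2 + 1),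
            Real.cos (((k : ℝ) - 1 - 2 * (n : ℝ)) * s) /
              ((2 * (n : ℝ) - 1) * (2 * (n : ℝ) + 1) * (2 * (n : ℝ) + 3))) := by
  obtain ⟨m, rfl⟩ := hk
  have hexp (t : ℝ) : Complex.exp ((2 * m + 1 : ℕ) * t * Complex.I) =
      ⟨Real.cos ((2 * m + 1 : ℕ) * t), Real.sin ((2 * m + 1 : ℕ) * t)⟩ := by
    rw [Complex.exp_mul_I, Complex.mk_eq_add_mul_I]
    push_cast
    rfl
  constructor
  · convert hasHalfLaplacianS_clm_exp Complex.reCLM m hs using 1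
    · simp only [hexp, Complex.reCLM_apply]
    · rw [oddClosedForm_eq_mk, neg_two_I_div_pi_mul, Complex.reCLM_apply]
      ring
  · convert hasHalfLaplacianS_clm_exp Complex.imCLM m hs using 1
    · simp only [hexp, Complex.imCLM_apply]
    · rw [oddClosedForm_eq_mk, neg_two_I_div_pi_mul, Complex.imCLM_apply,
        ← div_div 2 Real.pi]
      ring
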